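/- Let $\mathbb{F}$ be an arbitrary field, let $V$ be an infinite-dimensional vector space over $\mathbb{F}$, let $u$ be an endomorphism of $V$ of finite rank (that is, its range is finite-dimensional), and let $\alpha \in \mathbb{F}$. Then $f := \alpha\,\mathrm{id}_V + u$ is a linear combination of three idempotent endomorphisms of $V$: there exist scalars $a, b, c \in \mathbb{F}$ and endomorphisms $P, Q, R$ of $V$ with $P^2 = P$, $Q^2 = Q$, $R^2 = R$ such that $\alpha\,\mathrm{id}_V + u = a P + b Q + c R$. -/

import Mathlib

/-! If `α ≠ 0` and `u = a P + b Q - α R`, then `α + u = a P + b Q + α (1 - R)`. So it suffices to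
decompose `u` with one coefficient `c ≠ 0` prescribed.

Let `W` be the range of `u` and `B` the restriction of `u` to `W`. The kernel of `u` is
infinite-dimensional, so `u` has a right inverse on `W` whose image is independent of `W`. Hence `u`
is `[[0, 0], [1, B]]` on a copy of `W × W` and zero on a complement. This block operator is a
combination of three idempotents as soon as `B - (a + c) - b E = Z X - X Z` with `E` idempotent and
`X E = X`.

A scalar `B` is settled with `X = Z = 0`. Otherwise put `τ = tr B - c dim W`. If `τ = 0`, take `E =
1`, `a = 1`, `b = -1`: the traceless nonscalar `B - c` is a commutator. If `τ ≠ 0`, take `E = 1 - G`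
with `G` a rank-one idempotent, and choose `a`, `b` so that `B - (a + b + c) + b G` has trace zero.
It is then a commutator, and `X E = X` becomes `X G = 0`. In both cases the commutator comes from a
Hessenberg basis and works in every characteristic. -/

theorem LinearMap.comp_comp_idempotent {F W V : Type*} [Field F] [AddCommGroup W] [Module F W]
    [AddCommGroup V] [Module F V] {j : W →ₗ[F] V} {p : V →ₗ[F] W} (hpj : p ∘ₗ j = LinearMap.id)
    {P : W →ₗ[F] W} (hP : P ∘ₗ P = P) : (j ∘ₗ P ∘ₗ p) ∘ₗ (j ∘ₗ P ∘ₗ p) = j ∘ₗ P ∘ₗ p := by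
  ext v
  have h1 := fun w => LinearMap.congr_fun hpj w
  have h2 := fun w => LinearMap.congr_fun hP w
  simp only [LinearMap.comp_apply, LinearMap.id_apply] at h1 h2 ⊢
  rw [h1, h2]

/-! ### Block operators and the reduction to the range -/

/-- The block operator `[[0, 0], [1, B]]` on `W × W` is a linear combination of three idempotents
as soon as `B - (a + c) - b E` is a commutator `Z X - X Z` with `E` idempotent and `X E = X`. -/
theorem exists_combination_block {F W : Type*} [Field F] [AddCommGroup W] [Module F W]
    {a b c : F} (ha : a ≠ 0) (hb : b ≠ 0) (hc : c ≠ 0) {B E X Z : W →ₗ[F] W}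
    (hE : E ∘ₗ E = E) (hX : X ∘ₗ E = X)
    (hB : B = (a + c) • LinearMap.id + b • E + (Z ∘ₗ X - X ∘ₗ Z)) :
    ∃ P Q R : (W × W) →ₗ[F] (W × W), P ∘ₗ P = P ∧ Q ∘ₗ Q = Q ∧ R ∘ₗ R = R ∧
      LinearMap.prod 0 (LinearMap.id.coprod B) = a • P + b • Q + c • R := by
  -- Conjugation by `S` turns the block operator into `[[D, D E'], [1, E']]`. Removing `c R` leaves
  -- `[[D, X], [1, E' - c]]`, which conjugation by `L'` turns into `[[a, X], [Y, b E]] = a P + b Q`.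
  -- The diagonal entries force `D` and `E'`, and the lower left entry forces `Y`.
  set D : W →ₗ[F] W := a • LinearMap.id - X ∘ₗ Z with hD
  set E' : W →ₗ[F] W := b • E + c • LinearMap.id + Z ∘ₗ X with hE'
  set Y : W →ₗ[F] W :=
    LinearMap.id - a • Z + Z ∘ₗ X ∘ₗ Z + b • (E ∘ₗ Z) with hY
  let S : (W × W) →ₗ[F] (W × W) :=
    LinearMap.prod (LinearMap.id.coprod D) ((0 : W →ₗ[F] W).coprod LinearMap.id)
  let S' : (W × W) →ₗ[F] (W × W) :=
    LinearMap.prod (LinearMap.id.coprod (-D)) ((0 : W →ₗ[F] W).coprod LinearMap.id)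
  let L : (W × W) →ₗ[F] (W × W) :=
    LinearMap.prod (LinearMap.id.coprod 0) (Z.coprod LinearMap.id)
  let L' : (W × W) →ₗ[F] (W × W) :=
    LinearMap.prod (LinearMap.id.coprod 0) ((-Z).coprod LinearMap.id)
  let P : (W × W) →ₗ[F] (W × W) :=
    LinearMap.prod (LinearMap.id.coprod 0) ((a⁻¹ • Y).coprod 0)
  let Q : (W × W) →ₗ[F] (W × W) :=
    LinearMap.prod ((0 : W →ₗ[F] W).coprod (b⁻¹ • X)) ((0 : W →ₗ[F] W).coprod E)
  let R : (W × W) →ₗ[F] (W × W) :=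
    LinearMap.prod ((0 : W →ₗ[F] W).coprod (c⁻¹ • (D ∘ₗ E' - X)))
      ((0 : W →ₗ[F] W).coprod LinearMap.id)
  have hXE : ∀ w, X (E w) = X w := fun w => LinearMap.congr_fun hX w
  have hEE : ∀ w, E (E w) = E w := fun w => LinearMap.congr_fun hE w
  have hSS : S ∘ₗ S' = LinearMap.id := by
    ext w <;> simp [S, S']
  have hLL : (L' ∘ₗ S) ∘ₗ (S' ∘ₗ L) = LinearMap.id := by
    ext w <;> simp [S, S', L, L']
  have hBD : ∀ w, B w = D w + E' w := fun w => by
    simp only [hB, hD, hE', LinearMap.add_apply, LinearMap.sub_apply, LinearMap.smul_apply,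
      LinearMap.comp_apply, LinearMap.id_apply]
    module
  refine ⟨(S' ∘ₗ L) ∘ₗ P ∘ₗ (L' ∘ₗ S), (S' ∘ₗ L) ∘ₗ Q ∘ₗ (L' ∘ₗ S), S' ∘ₗ R ∘ₗ S,
    LinearMap.comp_comp_idempotent hLL ?_, LinearMap.comp_comp_idempotent hLL ?_,
    LinearMap.comp_comp_idempotent hSS ?_, ?_⟩
  · ext w <;> simp [P]
  · ext w <;> simp [Q, hXE, hEE]
  · ext w <;> simp [R]
  · have key : ∀ x y : W, LinearMap.prod 0 (LinearMap.id.coprod B) (x, y) =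
        S' (L (a • P (L' (S (x, y))) + b • Q (L' (S (x, y)))) + c • R (S (x, y))) := by
      intro x y
      simp only [S, S', L, L', P, Q, R, LinearMap.prod_apply, Function.prod, LinearMap.coprod_apply,
        LinearMap.id_apply, LinearMap.zero_apply, LinearMap.neg_apply, LinearMap.smul_apply,
        Prod.smul_mk, Prod.mk_add_mk, smul_add, smul_inv_smul₀ ha, smul_inv_smul₀ hb,
        smul_inv_smul₀ hc, zero_add, add_zero, hBD]
      simp only [LinearMap.sub_apply, LinearMap.comp_apply]
      generalize hu : x + D y = t
      obtain rfl : x = t - D y := eq_sub_of_add_eq hu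
      simp only [hY, hE', hD, LinearMap.add_apply, LinearMap.sub_apply, LinearMap.smul_apply,
        LinearMap.comp_apply, LinearMap.id_apply, map_add, map_sub, map_smul, map_neg, Prod.mk.injEq]
      constructor <;> module
    refine LinearMap.ext fun v => ?_
    rw [show v = (v.1, v.2) from rfl, key]
    simp only [LinearMap.add_apply, LinearMap.smul_apply, LinearMap.comp_apply, map_add, map_smul]

/-- A finite-rank endomorphism of an infinite-dimensional space is, up to a zero summand, the block
operator `[[0, 0], [1, B]]`, where `B` is its restriction to its range. -/
theorem exists_block_form {F V : Type*} [Field F] [AddCommGroup V] [Module F V]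
    (hV : ¬ FiniteDimensional F V) (u : V →ₗ[F] V)
    (hu : FiniteDimensional F (LinearMap.range u)) :
    ∃ (j : (LinearMap.range u × LinearMap.range u) →ₗ[F] V)
      (p : V →ₗ[F] (LinearMap.range u × LinearMap.range u)),
      p ∘ₗ j = LinearMap.id ∧
      u = j ∘ₗ LinearMap.prod 0 (LinearMap.id.coprod
        (u.rangeRestrict ∘ₗ (LinearMap.range u).subtype)) ∘ₗ p := by
  let W := LinearMap.range u
  obtain ⟨e₀, he₀⟩ : ∃ e₀ : W →ₗ[F] V, u.rangeRestrict ∘ₗ e₀ = LinearMap.id :=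
    u.rangeRestrict.exists_rightInverse_of_surjective u.range_rangeRestrict
  -- `N` is finite-dimensional, so `ker u` still has infinite-dimensional image modulo `N`. Adding
  -- to `e₀` a map into `ker u` that is injective modulo `N` keeps it a right inverse and makes its
  -- range independent of `W`.
  let N : Submodule F V := W ⊔ LinearMap.range e₀
  let q : LinearMap.ker u →ₗ[F] V ⧸ N := N.mkQ ∘ₗ (LinearMap.ker u).subtype
  have hq : ¬ FiniteDimensional F (LinearMap.range q) := by
    intro h
    have hk : FiniteDimensional F (LinearMap.ker q) := by
      refine Module.Finite.of_injective
        (((LinearMap.ker u).subtype.restrict (p := LinearMap.ker q) (q := N) ?_)) ?_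
      · intro x hx
        simpa [q] using hx
      · intro x y hxy
        have := congrArg Subtype.val hxy
        exact Subtype.ext (Subtype.ext this)
    have := Module.Finite.equiv q.quotKerEquivRange.symm
    have := Module.Finite.of_submodule_quotient (LinearMap.ker q)
    have := Module.Finite.equiv u.quotKerEquivRange.symm
    exact hV (Module.Finite.of_submodule_quotient (LinearMap.ker u))
  obtain ⟨k₀, hk₀⟩ : ∃ k₀ : W →ₗ[F] LinearMap.range q, Function.Injective k₀ := by
    have h := mt Module.rank_lt_aleph0_iff.1 hq
    refine Module.Free.exists_linearMap_injective_of_lift_rank_lt ?_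
    refine (Cardinal.lift_lt_aleph0.2 (Module.rank_lt_aleph0 F W)).trans_le ?_
    exact Cardinal.aleph0_le_lift.2 (not_lt.1 h)
  obtain ⟨s, hs⟩ := q.rangeRestrict.exists_rightInverse_of_surjective q.range_rangeRestrict
  let k : W →ₗ[F] V := (LinearMap.ker u).subtype ∘ₗ s ∘ₗ k₀
  have hk : ∀ w, N.mkQ (k w) = k₀ w := fun w =>
    congrArg Subtype.val (LinearMap.congr_fun hs (k₀ w))
  have huk : ∀ w, u (k w) = 0 := fun w => (s (k₀ w)).2
  let e : W →ₗ[F] V := e₀ + k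
  have hue : ∀ w, u.rangeRestrict (e w) = w := fun w => by
    have h0 : u.rangeRestrict (e₀ w) = w := LinearMap.congr_fun he₀ w
    have h1 : u.rangeRestrict (k w) = 0 := Subtype.ext (huk w)
    simp [e, h0, h1]
  have hinj : LinearMap.ker (W.subtype.coprod e) = ⊥ := by
    rw [LinearMap.ker_eq_bot']
    rintro ⟨x, y⟩ h
    have hx : N.mkQ (x : V) = 0 := by
      simpa using (le_sup_left : W ≤ N) x.2
    have hy : N.mkQ (e₀ y) = 0 := by
      simpa using (le_sup_right : _ ≤ N) (LinearMap.mem_range_self e₀ y)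
    have h' := congrArg N.mkQ h
    simp only [LinearMap.coprod_apply, Submodule.subtype_apply, e, LinearMap.add_apply, map_add,
      hx, hy, hk, zero_add, map_zero] at h'
    have hy0 : y = 0 := hk₀ (by rw [map_zero]; exact Subtype.ext h')
    subst hy0
    simpa using h
  obtain ⟨g, hg⟩ := (W.subtype.coprod e).exists_leftInverse_of_injective hinj
  let p₂ : V →ₗ[F] W := LinearMap.fst F W W ∘ₗ g
  have hp₂ : ∀ x y : W, p₂ (x + e y) = x := fun x y => by
    have := LinearMap.congr_fun hg (x, y)
    simp only [LinearMap.comp_apply, LinearMap.coprod_apply, Submodule.subtype_apply] at this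
    simp [p₂, this]
  let B : W →ₗ[F] W := u.rangeRestrict ∘ₗ W.subtype
  refine ⟨e.coprod W.subtype, LinearMap.prod (u.rangeRestrict - B ∘ₗ p₂) p₂, ?_, ?_⟩
  · refine LinearMap.ext ?_
    rintro ⟨x, y⟩
    have h1 : p₂ (e x + y) = y := by rw [add_comm]; exact hp₂ y x
    have h2 : u.rangeRestrict (y : V) = B y := rfl
    simp only [LinearMap.comp_apply, LinearMap.coprod_apply, LinearMap.prod_apply, Function.prod,
      Submodule.subtype_apply, LinearMap.sub_apply, h1, LinearMap.id_apply, map_add u.rangeRestrict,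
      hue, h2, add_sub_cancel_right]
  · refine LinearMap.ext fun v => ?_
    simp [B]

/-! ### Commutators from parity-triangular matrices -/

theorem exists_recurrence {F W : Type*} [Field F] [AddCommGroup W] [Module F W]
    (Y : W →ₗ[F] W) (m : ℕ) (h : ℕ → W) (y : W) :
    ∃ t : ℕ → W, (∀ k < m, t k = h k + Y (t (k + 1))) ∧
      t 0 = ∑ k ∈ Finset.range m, (Y ^ k) (h k) + (Y ^ m) y := by
  induction m generalizing h with
  | zero => exact ⟨fun _ => y, by simp, by simp⟩
  | succ m ih =>
    obtain ⟨t, ht, ht0⟩ := ih fun k => h (k + 1)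
    refine ⟨fun k => Nat.casesOn k (h 0 + Y (t 0)) t, ?_, ?_⟩
    · rintro (_ | k) hk
      · rfl
      · exact ht k (by omega)
    · change h 0 + Y (t 0) = _
      simp only [ht0, Finset.sum_range_succ', map_add, map_sum, pow_succ', Module.End.mul_apply,
        pow_zero, Module.End.one_apply]
      abel

/-- An endomorphism whose compressions to the even-indexed and to the odd-indexed basis vectors are
upper triangular with trace zero is a commutator `Z X - X Z` with `X` killing the first basis
vector. -/
theorem exists_commutator_of_upperTriangular_parity {F W : Type*} [Field F] [AddCommGroup W]
    [Module F W] {n : ℕ} (e : Module.Basis (Fin n) F W) (C : W →ₗ[F] W)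
    (hC : ∀ i j : Fin n, j < i → (i : ℕ) % 2 = j % 2 → e.repr (C (e j)) i = 0)
    (htr : ∀ ε < 2, ∑ i : Fin n, (if (i : ℕ) % 2 = ε then e.repr (C (e i)) i else 0) = 0) :
    ∃ Z X : W →ₗ[F] W, C = Z ∘ₗ X - X ∘ₗ Z ∧ ∀ i : Fin n, (i : ℕ) = 0 → X (e i) = 0 := by
  let f : ℕ → W := fun i => if h : i < n then e ⟨i, h⟩ else 0
  have hf : ∀ i : Fin n, f i = e i := fun i => by simp [f]
  -- One Jordan block on each parity class, with eigenvalues 0 (even) and 1 (odd). The commutant of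
  -- `X` is spanned by the powers of the two nilpotent shifts, so for a parity-triangular `C` the
  -- only obstructions to `C = Z X - X Z` are the two traces.
  let X : W →ₗ[F] W := e.constr F fun i =>
    (((i : ℕ) % 2 : ℕ) : F) • e i + if 2 ≤ (i : ℕ) then f (i - 2) else 0
  have hX : ∀ i : Fin n, X (e i) =
      (((i : ℕ) % 2 : ℕ) : F) • e i + if 2 ≤ (i : ℕ) then f (i - 2) else 0 :=
    fun i => e.constr_basis F _ i
  let Y : ℕ → W →ₗ[F] W := fun ε => X - (ε : F) • LinearMap.id
  have hY : ∀ ε (i : Fin n), Y ε (e i) =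
      ((((i : ℕ) % 2 : ℕ) : F) - ε) • e i + if 2 ≤ (i : ℕ) then f (i - 2) else 0 := fun ε i => by
    simp only [Y, LinearMap.sub_apply, hX, LinearMap.smul_apply, LinearMap.id_apply]
    module
  have hYf : ∀ ε < 2, ∀ k, 2 * k + ε < n →
      Y ε (f (2 * k + ε)) = if k = 0 then 0 else f (2 * (k - 1) + ε) := by
    intro ε hε k hk
    have h1 := hY ε ⟨2 * k + ε, hk⟩
    rw [← hf] at h1
    have h2 : (2 * k + ε) % 2 = ε := by omega
    simp only [h2, sub_self, zero_smul, zero_add] at h1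
    rw [h1]
    rcases Nat.eq_zero_or_pos k with rfl | hk0
    · simp [hε]
    · rw [if_pos (by omega), if_neg (by omega)]
      congr 1
      omega
  have hpow : ∀ ε < 2, ∀ k l, l ≤ k → 2 * l + ε < n →
      (Y ε ^ k) (f (2 * l + ε)) = if l = k then f ε else 0 := by
    intro ε hε k
    induction k with
    | zero => intro l hl _; obtain rfl : l = 0 := by omega
              simp
    | succ k ih =>
      intro l hl hn
      rw [pow_succ, Module.End.mul_apply, hYf ε hε l hn]
      rcases Nat.eq_zero_or_pos l with rfl | hl0
      · simp
      · rw [if_neg (by omega), ih (l - 1) (by omega) (by omega)]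
        exact if_congr (by omega) rfl rfl
  -- `Y ε` is nilpotent on the vectors of parity `ε` and invertible on `U ε`, the span of the other
  -- parity.
  let U : ℕ → Submodule F W := fun ε => Submodule.span F (e '' {i | (i : ℕ) % 2 ≠ ε})
  have hU : ∀ ε (i : Fin n), (i : ℕ) % 2 ≠ ε → e i ∈ U ε := fun ε i hi =>
    Submodule.subset_span ⟨i, hi, rfl⟩
  have hfU : ∀ ε (i : Fin n), (i : ℕ) % 2 ≠ ε →
      (if 2 ≤ (i : ℕ) then f (i - 2) else 0) ∈ U ε := by
    intro ε i hi
    split_ifs with h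
    · have := hU ε ⟨i - 2, by omega⟩ (by simp only; omega)
      rwa [← hf] at this
    · exact zero_mem _
  have hYU : ∀ ε, (U ε).map (Y ε) ≤ U ε := by
    intro ε
    rw [Submodule.map_span_le]
    rintro _ ⟨i, hi, rfl⟩
    rw [hY]
    exact add_mem (Submodule.smul_mem _ _ (hU ε i hi)) (hfU ε i hi)
  have hUY : ∀ ε < 2, U ε ≤ (U ε).map (Y ε) := by
    intro ε hε
    rw [Submodule.span_le]
    have key : ∀ m (i : Fin n), (i : ℕ) = m → (i : ℕ) % 2 ≠ ε → e i ∈ (U ε).map (Y ε) := by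
      intro m
      induction m using Nat.strong_induction_on with
      | _ m ih =>
        intro i him hi
        have hprev : (if 2 ≤ (i : ℕ) then f (i - 2) else 0) ∈ (U ε).map (Y ε) := by
          split_ifs with h
          · have := ih (m - 2) (by omega) ⟨i - 2, by omega⟩ (by simp only; omega)
              (by simp only; omega)
            rwa [← hf] at this
          · exact zero_mem _
        have hs : ((((i : ℕ) % 2 : ℕ) : F) - ε) * ((((i : ℕ) % 2 : ℕ) : F) - ε) = 1 := by
          obtain ⟨h1, h2⟩ | ⟨h1, h2⟩ : ((i : ℕ) % 2 = 0 ∧ ε = 1) ∨ ((i : ℕ) % 2 = 1 ∧ ε = 0) := by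
            omega
          · simp [h1, h2]
          · simp [h1, h2]
        have h3 := sub_mem (Submodule.mem_map_of_mem (f := Y ε) (hU ε i hi)) hprev
        rw [hY, add_sub_cancel_right] at h3
        have h4 := Submodule.smul_mem _ ((((i : ℕ) % 2 : ℕ) : F) - ε) h3
        rwa [smul_smul, hs, one_smul] at h4
    rintro _ ⟨i, hi, rfl⟩
    exact key i i rfl hi
  have hpowU : ∀ ε k, ∀ w ∈ U ε, (Y ε ^ k) w ∈ U ε := by
    intro ε k
    induction k with
    | zero => intro w hw; simpa using hw
    | succ k ih =>
      intro w hw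
      rw [pow_succ', Module.End.mul_apply]
      exact hYU ε (Submodule.mem_map_of_mem (ih w hw))
  have hUpow : ∀ ε < 2, ∀ k, ∀ w ∈ U ε, ∃ y ∈ U ε, (Y ε ^ k) y = w := by
    intro ε hε k
    induction k with
    | zero => intro w hw; exact ⟨w, hw, by simp⟩
    | succ k ih =>
      intro w hw
      obtain ⟨w', hw', rfl⟩ := hUY ε hε hw
      obtain ⟨y, hy, rfl⟩ := ih w' hw'
      exact ⟨y, hy, by rw [pow_succ', Module.End.mul_apply]⟩
  -- Modulo `U ε`, triangularity leaves only `e l` of parity `ε` with `l ≤ j`. The power `Y ε ^ k`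
  -- kills those with `l < j` and sends `e j` to `f ε`.
  have hcol : ∀ ε < 2, ∀ (k : ℕ) (j : Fin n), (j : ℕ) = 2 * k + ε →
      (Y ε ^ k) (C (e j)) - e.repr (C (e j)) j • f ε ∈ U ε := by
    intro ε hε k j hj
    have h1 : e.repr (C (e j)) j • f ε =
        ∑ i : Fin n, if i = j then e.repr (C (e j)) i • f ε else 0 := by simp
    have h2 : (Y ε ^ k) (C (e j)) = ∑ i : Fin n, (Y ε ^ k) (e.repr (C (e j)) i • e i) := by
      rw [← map_sum, e.sum_repr]
    rw [h1, h2, ← Finset.sum_sub_distrib]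
    refine Submodule.sum_mem _ fun i _ => ?_
    rw [map_smul]
    by_cases hi : (i : ℕ) % 2 = ε
    · obtain ⟨l, hl⟩ : ∃ l, (i : ℕ) = 2 * l + ε := ⟨i / 2, by omega⟩
      rcases lt_or_ge k l with hkl | hkl
      · have hji : j < i := by rw [Fin.lt_def]; omega
        rw [hC i j hji (by omega), if_neg hji.ne']
        simp
      · rw [← hf i, hl, hpow ε hε k l hkl (by omega)]
        have : i = j ↔ l = k := by rw [Fin.ext_iff]; omega
        by_cases hlk : l = k
        · simp [hlk, this.2 hlk]
        · simp [hlk, this]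
    · rw [if_neg (by rintro rfl; omega), sub_zero]
      exact Submodule.smul_mem _ _ (hpowU ε k _ (hU ε i hi))
  -- Here `t (k + 1)` is to be `Z (f (2 * k + ε))`, and the recurrence is `C = Z X - X Z` evaluated
  -- at `f (2 * k + ε)`. Unrolled, `t 0 = 0` asks that the sum in `hS` lie in the range of `Y ε ^
  -- n`; the zero trace puts it in `U ε`, where that power is onto.
  have main : ∀ ε < 2, ∃ t : ℕ → W, t 0 = 0 ∧ ∀ k, 2 * k + ε < n →
      t k = C (f (2 * k + ε)) + Y ε (t (k + 1)) := by
    intro ε hε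
    have hS : ∑ k ∈ Finset.range n, (Y ε ^ k) (C (f (2 * k + ε))) ∈ U ε := by
      have h0 : ∑ k ∈ Finset.range n,
          (if h : 2 * k + ε < n then e.repr (C (e ⟨2 * k + ε, h⟩)) ⟨2 * k + ε, h⟩ else 0) = 0 := by
        refine Eq.trans ?_ (htr ε hε)
        rw [← Finset.sum_filter]
        symm
        refine Finset.sum_of_injOn (fun i : Fin n => (i : ℕ) / 2) ?_ ?_ ?_ ?_
        · intro i hi j hj hij
          simp only [Finset.coe_filter, Finset.mem_univ, true_and, Set.mem_ofPred_eq] at hi hj hij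
          exact Fin.ext (by omega)
        · intro i hi
          simp only [Finset.coe_range, Set.mem_Iio]
          omega
        · intro k _ hk
          rw [dif_neg]
          intro h
          exact hk ⟨⟨2 * k + ε, h⟩, by simp; omega, by simp only; omega⟩
        · intro i hi
          have hi' : 2 * ((i : ℕ) / 2) + ε = i := by
            simp only [Finset.mem_filter, Finset.mem_univ, true_and] at hi
            omega
          simp [hi']
      have h1 := Submodule.sum_mem (U ε) (t := Finset.range n) (f := fun k =>
        (Y ε ^ k) (C (f (2 * k + ε))) - (if h : 2 * k + ε < n then
          e.repr (C (e ⟨2 * k + ε, h⟩)) ⟨2 * k + ε, h⟩ else 0) • f ε) (fun k _ => by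
          by_cases h : 2 * k + ε < n
          · simpa [f, h] using hcol ε hε k ⟨2 * k + ε, h⟩ rfl
          · simp [f, h])
      rwa [Finset.sum_sub_distrib, ← Finset.sum_smul, h0, zero_smul, sub_zero] at h1
    obtain ⟨y, -, hy⟩ := hUpow ε hε n _ (neg_mem hS)
    obtain ⟨t, ht, ht0⟩ := exists_recurrence (Y ε) n (fun k => C (f (2 * k + ε))) y
    exact ⟨t, by rw [ht0, hy, add_neg_cancel], fun k hk => ht k (by omega)⟩
  choose! t ht0 ht using main
  let Z : W →ₗ[F] W := e.constr F fun i => t (i % 2) (i / 2 + 1)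
  have hZ : ∀ i : Fin n, Z (e i) = t (i % 2) (i / 2 + 1) := fun i => e.constr_basis F _ i
  refine ⟨Z, X, e.ext fun i => ?_, ?_⟩
  · have hi2 : (i : ℕ) % 2 < 2 := Nat.mod_lt _ two_pos
    have hi : 2 * ((i : ℕ) / 2) + i % 2 = i := Nat.div_add_mod _ _
    have h1 := ht (i % 2) hi2 (i / 2) (by omega)
    rw [hi, hf] at h1
    have h2 : Z (if 2 ≤ (i : ℕ) then f (i - 2) else 0) = t (i % 2) (i / 2) := by
      split_ifs with h
      · have h3 := hZ ⟨i - 2, by omega⟩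
        rw [← hf] at h3
        simp only at h3
        rw [h3, show ((i : ℕ) - 2) % 2 = i % 2 by omega,
          show ((i : ℕ) - 2) / 2 + 1 = i / 2 by omega]
      · rw [map_zero, show (i : ℕ) / 2 = 0 by omega, ht0 _ hi2]
    simp only [LinearMap.sub_apply, LinearMap.comp_apply, hX, map_add, map_smul, h2, hZ, h1, Y,
      LinearMap.smul_apply, LinearMap.id_apply]
    module
  · intro i hi
    simp [hX, hi]

/-! ### Hessenberg bases and nonscalar endomorphisms -/

theorem exists_hessenberg_sequence {F W : Type*} [Field F] [AddCommGroup W] [Module F W]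
    [FiniteDimensional F W] (C : W →ₗ[F] W) {v : W} (hv : LinearIndependent F ![v, C v])
    (k : ℕ) (h2 : 2 ≤ k) (hk : k ≤ Module.finrank F W) :
    ∃ e : ℕ → W, LinearIndepOn F e (Set.Iio k) ∧ e 0 = v ∧ e 1 = C v ∧
      ∀ j, j + 1 < k → C (e j) ∈ Submodule.span F (e '' Set.Iic (j + 1)) := by
  induction k, h2 using Nat.le_induction with
  | base =>
    refine ⟨fun i => if i = 0 then v else C v, ?_, by simp, by simp, ?_⟩
    · have hI : (Set.Iio 2 : Set ℕ) = insert 1 {0} := by ext i; simp; omega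
      have hv0 : v ≠ 0 := hv.ne_zero 0
      rw [LinearIndependent.pair_iff' hv0] at hv
      rw [hI, linearIndepOn_insert (by simp)]
      refine ⟨LinearIndepOn.singleton (by simpa using hv0), ?_⟩
      simpa [Submodule.mem_span_singleton] using hv
    · intro j hj
      obtain rfl : j = 0 := by omega
      exact Submodule.subset_span ⟨1, by simp⟩
  | succ k h2 ih =>
    obtain ⟨e, he, he0, he1, heC⟩ := ih (by omega)
    -- The next vector is `C (e (k - 1))` when it is new, and otherwise any vector outside the
    -- current span.
    obtain ⟨w, hw, hCw⟩ : ∃ w, w ∉ Submodule.span F (e '' Set.Iio k) ∧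
        (C (e (k - 1)) ∉ Submodule.span F (e '' Set.Iio k) → C (e (k - 1)) = w) := by
      by_cases h : C (e (k - 1)) ∈ Submodule.span F (e '' Set.Iio k)
      · have : ∃ w, w ∉ Submodule.span F (e '' Set.Iio k) := by
          by_contra! hall
          have h1 : Submodule.span F (e '' Set.Iio k) = ⊤ := by
            rw [eq_top_iff]; exact fun w _ => hall w
          classical
          have h3 := finrank_span_finset_le_card (R := F) ((Finset.range k).image e)
          rw [Set.finrank, Finset.coe_image, Finset.coe_range, h1, finrank_top] at h3
          have h4 := h3.trans Finset.card_image_le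
          rw [Finset.card_range] at h4
          omega
        obtain ⟨w, hw⟩ := this
        exact ⟨w, hw, fun h' => absurd h h'⟩
      · exact ⟨_, h, fun _ => rfl⟩
    have hupd : ∀ i, i ≠ k → Function.update e k w i = e i := fun i hi =>
      Function.update_of_ne hi _ _
    have himg : ∀ s : Set ℕ, k ∉ s → Function.update e k w '' s = e '' s := fun s hs =>
      Set.image_congr fun i hi => hupd i (by rintro rfl; exact hs hi)
    refine ⟨Function.update e k w, ?_, ?_, ?_, ?_⟩
    · have hI : (Set.Iio (k + 1) : Set ℕ) = insert k (Set.Iio k) := by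
        ext i; simp only [Set.mem_Iio, Set.mem_insert_iff]; omega
      rw [hI, linearIndepOn_insert (by simp)]
      refine ⟨he.congr fun i hi => (hupd i (Set.mem_Iio.1 hi).ne).symm, ?_⟩
      rw [himg _ (by simp), Function.update_self]
      exact hw
    · rw [hupd _ (by omega), he0]
    · rw [hupd _ (by omega), he1]
    · intro j hj
      rw [hupd _ (by omega)]
      rcases Nat.lt_or_ge (j + 1) k with hjk | hjk
      · rw [himg _ (by simp; omega)]
        exact heC j hjk
      · obtain rfl : k = j + 1 := by omega
        simp only [Nat.add_sub_cancel] at hCw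
        by_cases h : C (e j) ∈ Submodule.span F (e '' Set.Iio (j + 1))
        · rw [← himg _ (by simp)] at h
          exact Submodule.span_mono (Set.image_mono Set.Iio_subset_Iic_self) h
        · exact Submodule.subset_span ⟨j + 1, by simp, by rw [Function.update_self, hCw h]⟩

theorem exists_hessenberg_basis {F W : Type*} [Field F] [AddCommGroup W] [Module F W]
    [FiniteDimensional F W] (C : W →ₗ[F] W) {v : W} (hv : LinearIndependent F ![v, C v]) :
    ∃ (n : ℕ) (e : Module.Basis (Fin (n + 2)) F W), e 1 = C (e 0) ∧
      ∀ i j : Fin (n + 2), (j : ℕ) + 1 < i → e.repr (C (e j)) i = 0 := by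
  have hr : 2 ≤ Module.finrank F W := by simpa using hv.fintype_card_le_finrank
  obtain ⟨n, hn⟩ := Nat.exists_eq_add_of_le' hr
  obtain ⟨e, he, he0, he1, heC⟩ := exists_hessenberg_sequence C hv (n + 2) (by omega) hn.ge
  have hli : LinearIndependent F fun i : Fin (n + 2) => e i :=
    he.comp (fun i : Fin (n + 2) => (⟨i, i.2⟩ : Set.Iio (n + 2))) fun i j hij => by
      exact Fin.ext (congrArg Subtype.val hij)
  let b := basisOfLinearIndependentOfCardEqFinrank hli (by simp [hn])
  have hb : ∀ i, b i = e i := fun i => by simp [b]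
  refine ⟨n, b, by simp [hb, he0, he1], fun i j hij => ?_⟩
  have h1 := heC j (by omega)
  have h2 : e '' Set.Iic (j + 1 : ℕ) ⊆ b '' {l | (l : ℕ) ≤ j + 1} := by
    rintro _ ⟨l, hl, rfl⟩
    have hl' : l ≤ (j : ℕ) + 1 := hl
    exact ⟨⟨l, by omega⟩, hl', hb _⟩
  have h3 := b.mem_span_image.1 (Submodule.span_mono h2 h1)
  by_contra h
  rw [← hb] at h3
  have h4 : (i : ℕ) ≤ j + 1 := h3 (Finsupp.mem_support_iff.2 h)
  omega

/-- A nonscalar endomorphism becomes a commutator `Z X - X Z` after adding a multiple of a rank-one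
idempotent `G` that makes the trace vanish; moreover `X` kills the range of `G`. -/
theorem exists_add_smul_idempotent_eq_commutator {F W : Type*} [Field F] [AddCommGroup W]
    [Module F W] [FiniteDimensional F W] (C : W →ₗ[F] W)
    (hC : ∀ β : F, C ≠ β • LinearMap.id) {κ : F} (hκ : LinearMap.trace F W C + κ = 0) :
    ∃ Z X G : W →ₗ[F] W, G ∘ₗ G = G ∧ X ∘ₗ G = 0 ∧ C + κ • G = Z ∘ₗ X - X ∘ₗ Z := by
  obtain ⟨v, hv⟩ : ∃ v, LinearIndependent F ![v, C v] := by
    by_contra! h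
    obtain ⟨β, hβ⟩ := LinearMap.exists_eq_smul_id_of_forall_notLinearIndependent h
    exact hC β hβ
  obtain ⟨n, e, he1, hes⟩ := exists_hessenberg_basis C hv
  let c : Fin (n + 2) → Fin (n + 2) → F := fun i j => e.repr (C (e j)) i
  have hc10 : ∀ i, c i 0 = if i = 1 then 1 else 0 := fun i => by
    simp [c, ← he1, Finsupp.single_apply, eq_comm]
  -- Replacing `e 1` by `e 1 + δ • e 0` moves `δ` from diagonal entry 0 to entry 1, because `C (e 0)
  -- = e 1`. This `δ` makes the even trace of `C + κ • G` vanish; the odd one follows from the total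
  -- trace.
  let δ : F := ∑ i : Fin (n + 2), (if (i : ℕ) % 2 = 0 then c i i else 0) + κ
  have hN : (δ • e.coord 1) (e 0) = 0 := by simp
  let φ : W ≃ₗ[F] W := LinearEquiv.transvection hN
  have hφ : ∀ w, φ w = w + (δ * e.repr w 1) • e 0 := fun w => rfl
  have hφs : ∀ w, φ.symm w = w - (δ * e.repr w 1) • e 0 := fun w => by
    rw [LinearEquiv.symm_apply_eq, hφ]
    simp
  let e' := e.map φ
  let G : W →ₗ[F] W := (e'.coord 0).smulRight (e' 0)
  have hG : ∀ w, G w = e'.repr w 0 • e' 0 := fun w => rfl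
  have hCe : ∀ i j, e'.repr (C (e' j)) i =
      c i j + (if j = 1 then δ * c i 0 else 0) -
        (if i = 0 then δ * (c 1 j + if j = 1 then δ else 0) else 0) := by
    intro i j
    have h1 : C (e' j) = C (e j) + (if j = 1 then δ else 0) • C (e 0) := by
      by_cases hj : j = 1 <;> simp [e', hφ, hj]
    have h2 : e'.repr (C (e' j)) i = e.repr (φ.symm (C (e' j))) i := rfl
    have h3 : e.repr (e 0) i = if i = 0 then 1 else 0 := by
      simp [Finsupp.single_apply, eq_comm]
    have h4 : e.repr (C (e 0)) 1 = 1 := by simp [← he1]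
    rw [h2, hφs, h1]
    simp only [map_add, map_sub, map_smul, Finsupp.add_apply, Finsupp.sub_apply,
      Finsupp.smul_apply, smul_eq_mul, h3, h4, c]
    split_ifs <;> ring
  have hGe : ∀ i j, e'.repr (G (e' j)) i = if i = 0 ∧ j = 0 then 1 else 0 := by
    intro i j
    by_cases hj : j = 0 <;> by_cases hi : i = 0 <;>
      simp [hG, hi, hj, eq_comm]
  have hrep : ∀ i j, e'.repr ((C + κ • G) (e' j)) i =
      e'.repr (C (e' j)) i + κ * if i = 0 ∧ j = 0 then 1 else 0 := fun i j => by
    simp [← hGe]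
  have hdiag : ∀ i, e'.repr ((C + κ • G) (e' i)) i =
      c i i + (if i = 1 then δ else 0) + if i = 0 then κ - δ else 0 := fun i => by
    rw [hrep, hCe]
    by_cases h1 : i = 1
    · subst h1; simp [hc10]
    · by_cases h0 : i = 0
      · subst h0; simp [hc10]; ring
      · simp [h0, h1]
  have heven : ∑ i : Fin (n + 2),
      (if (i : ℕ) % 2 = 0 then e'.repr ((C + κ • G) (e' i)) i else 0) = 0 := by
    have : ∀ i : Fin (n + 2),
        (if (i : ℕ) % 2 = 0 then e'.repr ((C + κ • G) (e' i)) i else 0) =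
        (if (i : ℕ) % 2 = 0 then c i i else 0) + if i = 0 then κ - δ else 0 := fun i => by
      rw [hdiag]
      by_cases h1 : i = 1
      · subst h1; simp
      · by_cases h0 : i = 0
        · subst h0; simp
        · simp [h0, h1]
    simp only [this, Finset.sum_add_distrib, Finset.sum_ite_eq', Finset.mem_univ, if_true, δ]
    ring
  have htot : ∑ i : Fin (n + 2), e'.repr ((C + κ • G) (e' i)) i = 0 := by
    simp only [hdiag, Finset.sum_add_distrib, Finset.sum_ite_eq', Finset.mem_univ, if_true]
    rw [LinearMap.trace_eq_matrix_trace F e] at hκ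
    simp only [Matrix.trace, Matrix.diag, LinearMap.toMatrix_apply] at hκ
    simp only [c]
    linear_combination hκ
  obtain ⟨Z, X, hZX, hX0⟩ := exists_commutator_of_upperTriangular_parity e' (C + κ • G) (by
    intro i j hji hpar
    have hij : (j : ℕ) + 1 < i := by rw [Fin.lt_def] at hji; omega
    have hi0 : i ≠ 0 := by rintro rfl; simp at hij
    have hi1 : i ≠ 1 := by rintro rfl; simp at hij
    rw [hrep, hCe]
    simp [hi0, hi1, hc10, c, hes i j hij]) (by
    intro ε hε
    obtain rfl | rfl : ε = 0 ∨ ε = 1 := by omega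
    · exact heven
    · have h1 : ∀ i : Fin (n + 2), (if (i : ℕ) % 2 = 1 then e'.repr ((C + κ • G) (e' i)) i else 0) =
          e'.repr ((C + κ • G) (e' i)) i -
          (if (i : ℕ) % 2 = 0 then e'.repr ((C + κ • G) (e' i)) i else 0) := fun i => by
        rcases Nat.mod_two_eq_zero_or_one i with h | h <;> simp [h]
      simp only [h1, Finset.sum_sub_distrib, htot, heven, sub_zero])
  refine ⟨Z, X, G, ?_, ?_, hZX⟩
  · refine LinearMap.ext fun w => ?_
    simp [hG]
  · refine LinearMap.ext fun w => ?_
    simp [hG, hX0 0 rfl]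

/-! ### Choice of coefficients and conclusion -/

theorem exists_combination_of_commutator {F V : Type*} [Field F] [AddCommGroup V] [Module F V]
    (hV : ¬ FiniteDimensional F V) (u : V →ₗ[F] V)
    (hu : FiniteDimensional F (LinearMap.range u)) {a b c : F} (ha : a ≠ 0) (hb : b ≠ 0)
    (hc : c ≠ 0) {E X Z : LinearMap.range u →ₗ[F] LinearMap.range u} (hE : E ∘ₗ E = E)
    (hX : X ∘ₗ E = X)
    (hB : u.rangeRestrict ∘ₗ (LinearMap.range u).subtype =
      (a + c) • LinearMap.id + b • E + (Z ∘ₗ X - X ∘ₗ Z)) :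
    ∃ P Q R : V →ₗ[F] V, P ∘ₗ P = P ∧ Q ∘ₗ Q = Q ∧ R ∘ₗ R = R ∧
      u = a • P + b • Q + c • R := by
  obtain ⟨j, p, hpj, hjp⟩ := exists_block_form hV u hu
  obtain ⟨P, Q, R, hP, hQ, hR, hM⟩ := exists_combination_block ha hb hc hE hX hB
  refine ⟨j ∘ₗ P ∘ₗ p, j ∘ₗ Q ∘ₗ p, j ∘ₗ R ∘ₗ p, LinearMap.comp_comp_idempotent hpj hP,
    LinearMap.comp_comp_idempotent hpj hQ, LinearMap.comp_comp_idempotent hpj hR, ?_⟩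
  rw [hM] at hjp
  refine LinearMap.ext fun v => ?_
  conv_lhs => rw [hjp]
  simp only [LinearMap.comp_apply, LinearMap.add_apply, LinearMap.smul_apply, map_add, map_smul]

/-- With `r` the image of `dim W` in `F`, this is the trace condition on `B - (a + b + c) + b G`.
When `r` is neither 0 nor 1, `r` itself witnesses a third scalar `x`, so `τ` splits into nonzero
parts `x τ` and `(1 - x) τ`. -/
theorem exists_ne_zero_mul_add_sub_one_mul_eq {F : Type*} [Field F] (r : F) {τ : F}
    (hτ : τ ≠ 0) : ∃ a b : F, a ≠ 0 ∧ b ≠ 0 ∧ r * a + (r - 1) * b = τ := by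
  by_cases h0 : r = 0
  · exact ⟨1, -τ, one_ne_zero, neg_ne_zero.2 hτ, by rw [h0]; ring⟩
  by_cases h1 : r = 1
  · exact ⟨τ, 1, hτ, one_ne_zero, by rw [h1]; ring⟩
  have h1' : r - 1 ≠ 0 := sub_ne_zero.2 h1
  obtain ⟨x, hx0, hx1⟩ : ∃ x : F, x ≠ 0 ∧ x ≠ 1 := ⟨r, h0, h1⟩
  have hx1' : 1 - x ≠ 0 := sub_ne_zero.2 hx1.symm
  refine ⟨x * τ / r, (1 - x) * τ / (r - 1), div_ne_zero (mul_ne_zero hx0 hτ) h0,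
    div_ne_zero (mul_ne_zero hx1' hτ) h1', ?_⟩
  field_simp
  ring

/-- In an infinite-dimensional space, a finite-rank endomorphism is a linear combination of three
idempotents, one of the coefficients being any prescribed nonzero scalar. -/
theorem exists_combination_of_finite_rank {F V : Type*} [Field F] [AddCommGroup V] [Module F V]
    (hV : ¬ FiniteDimensional F V) (u : V →ₗ[F] V)
    (hu : FiniteDimensional F (LinearMap.range u)) {c : F} (hc : c ≠ 0) :
    ∃ (a b : F) (P Q R : V →ₗ[F] V), P ∘ₗ P = P ∧ Q ∘ₗ Q = Q ∧ R ∘ₗ R = R ∧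
      u = a • P + b • Q + c • R := by
  suffices h : ∃ (a b : F) (E X Z : LinearMap.range u →ₗ[F] LinearMap.range u),
      a ≠ 0 ∧ b ≠ 0 ∧ E ∘ₗ E = E ∧ X ∘ₗ E = X ∧
      u.rangeRestrict ∘ₗ (LinearMap.range u).subtype =
        (a + c) • LinearMap.id + b • E + (Z ∘ₗ X - X ∘ₗ Z) by
    obtain ⟨a, b, E, X, Z, ha, hb, hE, hX, hB⟩ := h
    exact ⟨a, b, exists_combination_of_commutator hV u hu ha hb hc hE hX hB⟩
  generalize u.rangeRestrict ∘ₗ (LinearMap.range u).subtype = B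
  by_cases hs : ∃ β : F, B = β • LinearMap.id
  · obtain ⟨β, rfl⟩ := hs
    by_cases hβ : β = c
    · exact ⟨1, -1, LinearMap.id, 0, 0, one_ne_zero, neg_ne_zero.2 one_ne_zero, by simp, by simp,
        by rw [hβ, LinearMap.comp_zero]; module⟩
    · exact ⟨β - c, 1, 0, 0, 0, sub_ne_zero.2 hβ, one_ne_zero, by simp, by simp, by simp⟩
  push Not at hs
  have hs' : ∀ s β : F, B - s • LinearMap.id ≠ β • LinearMap.id := fun s β h =>
    hs (β + s) (by rw [add_smul, ← h, sub_add_cancel])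
  have htr : ∀ s : F, LinearMap.trace F _ (B - s • LinearMap.id) =
      LinearMap.trace F _ B - s * (Module.finrank F (LinearMap.range u) : F) := fun s => by
    rw [map_sub, map_smul, LinearMap.trace_id, smul_eq_mul]
  by_cases hτ : LinearMap.trace F _ B - c * (Module.finrank F (LinearMap.range u) : F) = 0
  · obtain ⟨Z, X, G, -, -, hZX⟩ :=
      exists_add_smul_idempotent_eq_commutator (B - c • LinearMap.id) (hs' c) (κ := 0)
        (by rw [htr, hτ, add_zero])
    refine ⟨1, -1, LinearMap.id, X, Z, one_ne_zero, neg_ne_zero.2 one_ne_zero, by simp, by simp,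
      ?_⟩
    rw [← hZX]
    module
  · obtain ⟨a, b, ha, hb, hab⟩ := exists_ne_zero_mul_add_sub_one_mul_eq
      (Module.finrank F (LinearMap.range u) : F) hτ
    obtain ⟨Z, X, G, hG, hXG, hZX⟩ :=
      exists_add_smul_idempotent_eq_commutator (B - (a + b + c) • LinearMap.id) (hs' _) (κ := b)
        (by rw [htr]; linear_combination -hab)
    refine ⟨a, b, LinearMap.id - G, X, Z, ha, hb, ?_, ?_, ?_⟩
    · simp [LinearMap.sub_comp, LinearMap.comp_sub, hG]
    · simp [LinearMap.comp_sub, hXG]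
    · rw [← hZX]
      module

theorem mainTheorem9 {F : Type*} [Field F] {V : Type*} [AddCommGroup V] [Module F V]
    (hV : ¬ FiniteDimensional F V) (u : V →ₗ[F] V)
    (hu : FiniteDimensional F (LinearMap.range u)) (α : F) :
    ∃ (a b c : F) (P Q R : V →ₗ[F] V),
      P ∘ₗ P = P ∧ Q ∘ₗ Q = Q ∧ R ∘ₗ R = R ∧
        α • (LinearMap.id : V →ₗ[F] V) + u = a • P + b • Q + c • R := by
  by_cases hα : α = 0
  · obtain ⟨a, b, P, Q, R, hP, hQ, hR, h⟩ :=
      exists_combination_of_finite_rank hV u hu (one_ne_zero (α := F))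
    exact ⟨a, b, 1, P, Q, R, hP, hQ, hR, by rw [hα, zero_smul, zero_add]; exact h⟩
  · obtain ⟨a, b, P, Q, R, hP, hQ, hR, h⟩ :=
      exists_combination_of_finite_rank hV u hu (neg_ne_zero.2 hα)
    refine ⟨a, b, α, P, Q, LinearMap.id - R, hP, hQ, ?_, ?_⟩
    · simp [LinearMap.sub_comp, LinearMap.comp_sub, hR]
    · rw [h]
      module
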